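/- Throughout, a compact abelian group $G$ is understood to be Hausdorff and second countable; it is equipped with its Borel $\sigma$-algebra and its Haar measure $\mu$, normalised so that $\mu(G)=1$. For $f\in L^\infty(G)$ (complex-valued) the Gowers norms are defined recursively by $$\|f\|_{U^1(G)}=\left|\int_G f\,d\mu\right|,\qquad \|f\|_{U^{k+1}(G)}=\left(\int_G\|(T^hf)\overline f\|_{U^k(G)}^{2^k}\,d\mu(h)\right)^{1/2^{k+1}}\quad(k\ge 1),$$ where $T^hf(x)=f(x-h)$. A measurable map $P:G\to\mathbf R/\mathbf Z$ is a polynomial of degree $\le k-1$ if $\Delta_{h_1}\cdots\Delta_{h_k}P(x)=0$ for almost every $(x,h_1,\dots,h_k)\in G^{k+1}$, where $\Delta_hP(x)=P(x-h)-P(x)$. Write $e(x)=e^{2\pi i x}$. **Theorem 1.4.** For every integer $k\ge 1$ there is a function $c_k:[0,\infty)\to[0,\infty)$, depending only on $k$, with $c_k(\varepsilon)\to 0$ as $\varepsilon\to 0$ and $c_k(0)=0$, such that the following holds for every compact abelian group $G$ and every $f\in L^\infty(G)$ with $\|f\|_{L^\infty(G)}\le 1$. 1. One has $\|f\|_{U^k(G)}=1$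 if and only if $f=e(P)$ almost everywhere for some polynomial $P:G\to\mathbf R/\mathbf Z$ of degree $\le k-1$. 2. For every $\varepsilon\ge 0$, if $\|f\|_{U^k(G)}\ge 1-\varepsilon$, then there exists a polynomial $P:G\to\mathbf R/\mathbf Z$ of degree $\le k-1$ such that $\|f-e(P)\|_{L^1(G)}\le c_k(\varepsilon)$. -/

import Mathlib

open MeasureTheory Filter Topology

namespace Gowers

/-- The Gowers uniformity norm `‖f‖_{U^k(μ)}` of a function on a group with a translation-invariant
measure `μ`, defined recursively for `k = 1, 2, …` by `‖f‖_{U^1} = |∫ f dμ|` and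
`‖f‖_{U^{k+1}} = (∫ ‖(T^h f) * conj f‖_{U^k}^{2^k} dμ(h))^{1/2^{k+1}}`, where
`T^h f (x) = f (x - h)`. The value at `k = 0` is a placeholder. -/
noncomputable def uNorm {G : Type*} [AddCommGroup G] [MeasurableSpace G] (μ : Measure G) :
    ℕ → (G → ℂ) → ℝ
  | 0, _ => 0
  | 1, f => ‖∫ x, f x ∂μ‖
  | k + 2, f =>
      (∫ h, uNorm μ (k + 1) (fun x => f (x - h) * starRingEnd ℂ (f x)) ^ (2 ^ (k + 1)) ∂μ) ^
        ((1 : ℝ) / 2 ^ (k + 2))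

/-- The difference operator `Δ_h P (x) = P (x - h) - P x`. -/
def diff {G H : Type*} [AddCommGroup G] [AddCommGroup H] (h : G) (P : G → H) : G → H :=
  fun x => P (x - h) - P x

/-- The iterated difference `Δ_{h_1} ⋯ Δ_{h_m} P`. -/
def iterDiff {G H : Type*} [AddCommGroup G] [AddCommGroup H] :
    (m : ℕ) → (Fin m → G) → (G → H) → G → H
  | 0, _, P => P
  | m + 1, h, P => diff (h 0) (iterDiff m (fun i => h i.succ) P)

/-- `P` is a polynomial map of degree `< m`, that is of degree `≤ m - 1`: it is measurable, and
`Δ_{h_1} ⋯ Δ_{h_m} P (x) = 0` for almost every `(x, h_1, …, h_m)` in `G^{m+1}`. -/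
def IsPolynomialDegLT {G H : Type*} [AddCommGroup G] [MeasurableSpace G] [AddCommGroup H]
    [MeasurableSpace H] (μ : Measure G) [SigmaFinite μ] (m : ℕ) (P : G → H) : Prop :=
  Measurable P ∧
    ∀ᵐ z : G × (Fin m → G) ∂(μ.prod (Measure.pi fun _ => μ)), iterDiff m z.2 P z.1 = 0

/-- The character `e : ℝ/ℤ → ℂ`, `e (x mod 1) = exp (2 π i x)`. -/
noncomputable def e (x : UnitAddCircle) : ℂ := (AddCircle.toCircle x : ℂ)

theorem e_coe (x : ℝ) : e (x : UnitAddCircle) = Complex.exp (2 * Real.pi * Complex.I * x) := by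
  simp only [e, AddCircle.toCircle_apply_mk, Circle.coe_exp]
  congr 1
  push_cast
  ring

end Gowers

/-! Write `f = |f| e(φ)`. The power `‖f‖_{U^k}^{2^k}` is the mean over cubes of a product with
modulus at most `|f(x)|` and phase `Δ_h φ(x)`, where `Δ_h` stands for the `k`-fold difference. A
norm near 1 thus forces `|f|` near 1 and `Δ_h φ` near 0 on average
(`integral_le_one_sub_uNorm_pow`).

It remains to move `φ` slightly in `L^1` onto an exact polynomial, in two stages. Average to uniform
(`exists_uniform_correction`): for fixed `x` and random `t`, every vertex of the cube except `x` is
uniformly distributed, so `Δ_t Q(x)` is close to `(-1)^k Q(x)` when `Q` is small in `L^1`. With `Q =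
Δ_h φ` and `Δ_t Δ_h = Δ_h Δ_t`, this makes `Δ_h φ(x)` almost independent of `h`; subtracting that
common value, up to sign, makes all differences small everywhere. Uniform to exact
(`exists_iterDiff_eq_zero`): small differences lift to reals `c_h(x)` without wraparound, and
averaging `c_h` over `h` gives a small real function whose differences are exactly `± c_h`.
Subtracting it leaves a polynomial.

Taking `ε = 0` in the quantitative statement gives one half of the characterisation of norm 1; the
other half is immediate, since every cube product of `e(P)` is 1 almost everywhere. -/

namespace Gowers

/-! ### Algebra and elementary bounds for iterated differences -/

section Algebra

variable {G H K : Type*} [AddCommGroup G] [AddCommGroup H] [AddCommGroup K]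

theorem iterDiff_diff (m : ℕ) (h : Fin m → G) (a : G) (P : G → H) :
    iterDiff m h (diff a P) = diff a (iterDiff m h P) := by
  induction m with
  | zero => rfl
  | succ m ih =>
    simp only [iterDiff, ih]
    funext x
    simp only [diff]
    rw [sub_right_comm x (h 0) a]
    abel

theorem iterDiff_comm (m n : ℕ) (h : Fin m → G) (t : Fin n → G) (P : G → H) :
    iterDiff m h (iterDiff n t P) = iterDiff n t (iterDiff m h P) := by
  induction m with
  | zero => rfl
  | succ m ih => simp only [iterDiff, ih, iterDiff_diff]

theorem iterDiff_cons (m : ℕ) (a : G) (h : Fin m → G) (P : G → H) :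
    iterDiff (m + 1) (Fin.cons a h : Fin (m + 1) → G) P = diff a (iterDiff m h P) := by
  simp [iterDiff]

theorem iterDiff_sub (m : ℕ) (h : Fin m → G) (P Q : G → H) (x : G) :
    iterDiff m h (fun y => P y - Q y) x = iterDiff m h P x - iterDiff m h Q x := by
  induction m generalizing x with
  | zero => rfl
  | succ m ih =>
    simp only [iterDiff, diff, ih]
    abel

theorem iterDiff_map (m : ℕ) (h : Fin m → G) (φ : H →+ K) (P : G → H) (x : G) :
    iterDiff m h (fun y => φ (P y)) x = φ (iterDiff m h P x) := by
  induction m generalizing x with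
  | zero => rfl
  | succ m ih => simp only [iterDiff, diff, ih, map_sub]

theorem iterDiff_zsmul (m : ℕ) (h : Fin m → G) (n : ℤ) (P : G → H) (x : G) :
    iterDiff m h (fun y => n • P y) x = n • iterDiff m h P x :=
  iterDiff_map m h (zsmulAddGroupHom n) P x

end Algebra

section Bounds

theorem enorm_neg_one_pow_zsmul {H : Type*} [NormedAddCommGroup H] (k : ℕ) (a : H) :
    ‖((-1 : ℤ) ^ k) • a‖ₑ = ‖a‖ₑ := by
  rcases neg_one_pow_eq_or ℤ k with h | h <;> simp [h]

theorem norm_iterDiff_le {G H : Type*} [AddCommGroup G] [NormedAddCommGroup H] (m : ℕ)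
    (h : Fin m → G) {P : G → H} {C : ℝ} (hC : ∀ x, ‖P x‖ ≤ C) (x : G) :
    ‖iterDiff m h P x‖ ≤ 2 ^ m * C := by
  induction m generalizing x with
  | zero => simpa [iterDiff] using hC x
  | succ m ih =>
    simp only [iterDiff, diff]
    refine (norm_sub_le _ _).trans ?_
    have h1 := ih (fun i => h i.succ) (x - h 0)
    have h2 := ih (fun i => h i.succ) x
    rw [pow_succ]
    linarith

end Bounds

/-! ### Splitting off one direction, and averages of differences over random directions -/

section Pi

variable {G : Type*} [MeasurableSpace G] (μ : Measure G) [SigmaFinite μ]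

theorem lintegral_pi_succ (m : ℕ) {g : (Fin (m + 1) → G) → ENNReal} (hg : Measurable g) :
    ∫⁻ t, g t ∂(Measure.pi fun _ => μ) =
      ∫⁻ a, ∫⁻ t, g (Fin.cons a t) ∂(Measure.pi fun _ => μ) ∂μ := by
  have hp := (measurePreserving_piFinSuccAbove (fun _ : Fin (m + 1) => μ) 0).symm
  rw [← hp.lintegral_comp hg, lintegral_prod (fun z => g ((MeasurableEquiv.piFinSuccAbove (fun _ => G) 0).symm z))
    (hg.comp hp.measurable).aemeasurable]
  simp [MeasurableEquiv.piFinSuccAbove_symm_apply, Fin.insertNthEquiv, Fin.insertNth_zero']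

theorem integral_pi_succ {E : Type*} [NormedAddCommGroup E] [NormedSpace ℝ E]
    (m : ℕ) {g : (Fin (m + 1) → G) → E} (hg : Integrable g (Measure.pi fun _ => μ)) :
    ∫ t, g t ∂(Measure.pi fun _ => μ) =
      ∫ a, ∫ t, g (Fin.cons a t) ∂(Measure.pi fun _ => μ) ∂μ := by
  have hp := (measurePreserving_piFinSuccAbove (fun _ : Fin (m + 1) => μ) 0).symm
  rw [← hp.integral_comp (MeasurableEquiv.measurableEmbedding _), integral_prod]
  · simp [MeasurableEquiv.piFinSuccAbove_symm_apply, Fin.insertNthEquiv, Fin.insertNth_zero']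
  · exact (hp.integrable_comp_emb (MeasurableEquiv.measurableEmbedding _)).2 hg

end Pi

/-- The difference is a signed sum of `2 ^ m` values of `Q a`, each small on average over the
parameter `a`. The point and the directions stay fixed. -/
theorem lintegral_enorm_iterDiff_param_le {A G H : Type*} [MeasurableSpace A] (ν : Measure A)
    [AddCommGroup G] [NormedAddCommGroup H] [MeasurableSpace H] [BorelSpace H]
    [SecondCountableTopology H] (m : ℕ)
    (h : Fin m → G) {Q : A → G → H} (hQ : ∀ y, Measurable fun a => Q a y) {C : ENNReal}
    (hC : ∀ y, ∫⁻ a, ‖Q a y‖ₑ ∂ν ≤ C) (x : G) :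
    ∫⁻ a, ‖iterDiff m h (Q a) x‖ₑ ∂ν ≤ 2 ^ m * C := by
  have hm : ∀ (m : ℕ) (h : Fin m → G) (x : G), Measurable fun a => iterDiff m h (Q a) x := by
    intro m
    induction m with
    | zero => exact fun _ => hQ
    | succ m ih => exact fun h x => (ih _ _).sub (ih _ _)
  induction m generalizing x with
  | zero => simpa [iterDiff] using hC x
  | succ m ih =>
    calc ∫⁻ a, ‖iterDiff (m + 1) h (Q a) x‖ₑ ∂ν
        ≤ ∫⁻ a, (‖iterDiff m (fun i => h i.succ) (Q a) (x - h 0)‖ₑ +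
            ‖iterDiff m (fun i => h i.succ) (Q a) x‖ₑ) ∂ν :=
          lintegral_mono fun a => enorm_sub_le
      _ ≤ 2 ^ m * C + 2 ^ m * C := by
          rw [lintegral_add_right _ (hm _ _ _).enorm]
          exact add_le_add (ih _ _) (ih _ _)
      _ = _ := by rw [pow_succ, mul_assoc, two_mul, mul_add]

section Measure

variable {G H : Type*} [AddCommGroup G] [MeasurableSpace G] [MeasurableSub₂ G]
  [NormedAddCommGroup H] [MeasurableSpace H] [BorelSpace H] [SecondCountableTopology H]

theorem measurable_iterDiff_param {A : Type*} [MeasurableSpace A] (m : ℕ) {Q : A → G → H}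
    (hQ : Measurable fun p : A × G => Q p.1 p.2) :
    Measurable fun p : (A × G) × (Fin m → G) => iterDiff m p.2 (Q p.1.1) p.1.2 := by
  induction m with
  | zero => exact hQ.comp measurable_fst
  | succ m ih =>
    simp only [iterDiff, diff]
    refine Measurable.sub ?_ ?_
    · exact ih.comp (f := fun p : (A × G) × (Fin (m + 1) → G) =>
        ((p.1.1, p.1.2 - p.2 0), fun i : Fin m => p.2 i.succ)) (by fun_prop)
    · exact ih.comp (f := fun p : (A × G) × (Fin (m + 1) → G) =>
        (p.1, fun i : Fin m => p.2 i.succ)) (by fun_prop)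

theorem measurable_iterDiff {B : Type*} [MeasurableSpace B] {m : ℕ} {Q : G → H}
    (hQ : Measurable Q) {u : B → Fin m → G} (hu : Measurable u) {v : B → G} (hv : Measurable v) :
    Measurable fun b => iterDiff m (u b) Q (v b) :=
  (measurable_iterDiff_param (A := Unit) (Q := fun _ => Q) m (hQ.comp measurable_snd)).comp
    (f := fun b => (((), v b), u b)) (by fun_prop)

theorem measurable_diff {a : G} {Q : G → H} (hQ : Measurable Q) : Measurable (diff a Q) := by
  unfold diff
  exact (hQ.comp (measurable_id.sub_const a)).sub hQ

variable [MeasurableAdd₂ G] (μ : Measure G) [μ.IsAddLeftInvariant]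

theorem lintegral_enorm_iterDiff_le (m : ℕ) (h : Fin m → G) {Q : G → H} (hQ : Measurable Q) :
    ∫⁻ y, ‖iterDiff m h Q y‖ₑ ∂μ ≤ 2 ^ m * ∫⁻ y, ‖Q y‖ₑ ∂μ := by
  induction m with
  | zero => simp [iterDiff]
  | succ m ih =>
    have hm : Measurable fun y => iterDiff m (fun i => h i.succ) Q y :=
      measurable_iterDiff hQ measurable_const measurable_id
    calc ∫⁻ y, ‖iterDiff (m + 1) h Q y‖ₑ ∂μ
        ≤ ∫⁻ y, (‖iterDiff m (fun i => h i.succ) Q (y - h 0)‖ₑ +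
            ‖iterDiff m (fun i => h i.succ) Q y‖ₑ) ∂μ := by
          refine lintegral_mono fun y => ?_
          exact enorm_sub_le
      _ = ∫⁻ y, ‖iterDiff m (fun i => h i.succ) Q y‖ₑ ∂μ +
            ∫⁻ y, ‖iterDiff m (fun i => h i.succ) Q y‖ₑ ∂μ := by
          rw [lintegral_add_right _ hm.enorm,
            lintegral_sub_right_eq_self (fun y => ‖iterDiff m (fun i => h i.succ) Q y‖ₑ)]
      _ ≤ _ := by
          rw [pow_succ, mul_assoc, two_mul, mul_add]
          exact add_le_add (ih _) (ih _)

variable [IsProbabilityMeasure μ]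

/-- An iterated difference in arbitrary directions is controlled on average by those in random
directions. -/
theorem lintegral_enorm_iterDiff_le_lintegral_pi (m : ℕ) (h : Fin m → G) {Q : G → H}
    (hQ : Measurable Q) :
    ∫⁻ y, ‖iterDiff m h Q y‖ₑ ∂μ ≤
      2 ^ m * ∫⁻ u : Fin m → G, ∫⁻ y, ‖iterDiff m u Q y‖ₑ ∂μ ∂(Measure.pi fun _ => μ) := by
  induction m generalizing Q with
  | zero => simp [iterDiff]
  | succ m ih =>
    set R := iterDiff m (fun i => h i.succ) Q with hR
    have hRm : Measurable R := measurable_iterDiff hQ measurable_const measurable_id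
    have hd : Measurable fun p : G × G => diff p.1 R p.2 := by
      unfold diff; fun_prop
    have hbig : Measurable fun p : (Fin (m + 1) → G) × G => iterDiff (m + 1) p.1 Q p.2 :=
      measurable_iterDiff hQ (by fun_prop) (by fun_prop)
    -- For any `u`, `Δ_h R(y) = Δ_{h+u} R(y) - Δ_u R(y-h)`; when `u` is uniform, so is `h + u`. Each
    -- fixed direction is thus traded for a random one at the cost of a factor 2.
    have key : ∀ u, ∫⁻ y, ‖iterDiff (m + 1) h Q y‖ₑ ∂μ ≤
        ∫⁻ y, ‖diff (h 0 + u) R y‖ₑ ∂μ + ∫⁻ y, ‖diff u R y‖ₑ ∂μ := fun u => by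
      calc ∫⁻ y, ‖iterDiff (m + 1) h Q y‖ₑ ∂μ
          ≤ ∫⁻ y, (‖diff (h 0 + u) R y‖ₑ + ‖diff u R (y - h 0)‖ₑ) ∂μ := by
            refine lintegral_mono fun y => ?_
            refine le_trans (le_of_eq ?_) enorm_sub_le
            simp only [iterDiff, ← hR, diff, sub_sub]
            congr 1
            abel
        _ = _ := by
            rw [lintegral_add_left (measurable_diff hRm).enorm,
              lintegral_sub_right_eq_self (fun y => ‖diff u R y‖ₑ)]
    calc ∫⁻ y, ‖iterDiff (m + 1) h Q y‖ₑ ∂μ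
        = ∫⁻ _u, ∫⁻ y, ‖iterDiff (m + 1) h Q y‖ₑ ∂μ ∂μ := by simp
      _ ≤ ∫⁻ u, (∫⁻ y, ‖diff (h 0 + u) R y‖ₑ ∂μ + ∫⁻ y, ‖diff u R y‖ₑ ∂μ) ∂μ :=
          lintegral_mono key
      _ = 2 * ∫⁻ u, ∫⁻ y, ‖diff u R y‖ₑ ∂μ ∂μ := by
          rw [lintegral_add_right _ hd.enorm.lintegral_prod_right',
            lintegral_add_left_eq_self (fun u => ∫⁻ y, ‖diff u R y‖ₑ ∂μ), two_mul]
      _ ≤ 2 * ∫⁻ u, (2 ^ m * ∫⁻ t : Fin m → G, ∫⁻ y, ‖iterDiff m t (diff u Q) y‖ₑ ∂μ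
            ∂(Measure.pi fun _ => μ)) ∂μ := by
          gcongr with u
          rw [hR, ← iterDiff_diff]
          exact ih _ (measurable_diff hQ)
      _ = _ := by
          rw [lintegral_const_mul' _ _ (by simp), ← mul_assoc, ← pow_succ',
            lintegral_pi_succ μ m hbig.enorm.lintegral_prod_right']
          simp_rw [iterDiff_cons, iterDiff_diff]

variable [μ.IsNegInvariant] [MeasurableNeg G]

/-- For every fixed point, the iterated difference in random directions is on average close to the
contribution of that point. -/
theorem lintegral_enorm_iterDiff_sub_le (m : ℕ) {Q : G → H} (hQ : Measurable Q) (x : G) :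
    ∫⁻ t : Fin m → G, ‖iterDiff m t Q x - ((-1 : ℤ) ^ m) • Q x‖ₑ ∂(Measure.pi fun _ => μ) ≤
      2 ^ m * ∫⁻ y, ‖Q y‖ₑ ∂μ := by
  induction m with
  | zero => simp [iterDiff]
  | succ m ih =>
    have hm : Measurable fun t : Fin (m + 1) → G => iterDiff (m + 1) t Q x :=
      measurable_iterDiff hQ measurable_id measurable_const
    have hm1 : Measurable fun p : G × (Fin m → G) => iterDiff m p.2 Q p.1 :=
      measurable_iterDiff hQ (by fun_prop) (by fun_prop)
    have hm2 : Measurable fun t : Fin m → G => iterDiff m t Q x :=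
      measurable_iterDiff hQ (by fun_prop) (by fun_prop)
    have hms : Measurable fun t : Fin m → G =>
        ‖iterDiff m t Q x - ((-1 : ℤ) ^ m) • Q x‖ₑ := (hm2.sub_const _).enorm
    rw [lintegral_pi_succ μ m (hm.sub_const _).enorm]
    -- The face through `x - a` has a uniformly distributed base point, so it costs only the `L^1`
    -- norm of `Q`; the face through `x` is the inductive case.
    calc _ ≤ ∫⁻ a, ∫⁻ t : Fin m → G, (‖iterDiff m t Q (x - a)‖ₑ +
            ‖iterDiff m t Q x - ((-1 : ℤ) ^ m) • Q x‖ₑ) ∂(Measure.pi fun _ => μ) ∂μ := by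
          refine lintegral_mono fun a => lintegral_mono fun t => ?_
          rw [iterDiff_cons, diff]
          refine le_trans (le_of_eq ?_) enorm_sub_le
          congr 1
          rw [pow_succ, mul_neg_one, neg_smul]
          abel
      _ = ∫⁻ a, (∫⁻ t : Fin m → G, ‖iterDiff m t Q (x - a)‖ₑ ∂(Measure.pi fun _ => μ)) ∂μ +
            ∫⁻ t : Fin m → G, ‖iterDiff m t Q x - ((-1 : ℤ) ^ m) • Q x‖ₑ
              ∂(Measure.pi fun _ => μ) := by
          simp_rw [lintegral_add_right _ hms]
          rw [lintegral_add_right _ measurable_const]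
          simp
      _ ≤ 2 ^ m * ∫⁻ y, ‖Q y‖ₑ ∂μ + 2 ^ m * ∫⁻ y, ‖Q y‖ₑ ∂μ := by
          refine add_le_add ?_ ih
          rw [lintegral_sub_left_eq_self (fun a => ∫⁻ t : Fin m → G, ‖iterDiff m t Q a‖ₑ
            ∂(Measure.pi fun _ => μ)), lintegral_lintegral_swap hm1.enorm.aemeasurable]
          refine (lintegral_mono fun t => lintegral_enorm_iterDiff_le μ m t hQ).trans ?_
          simp
      _ = _ := by rw [pow_succ, mul_assoc, two_mul, mul_add]

end Measure

end Gowers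

namespace Gowers

/-! ### Metric comparison of the circle with `ℝ/ℤ`, circular means and lifts -/

section Circle

theorem e_add (x y : UnitAddCircle) : e (x + y) = e x * e y := by
  simp [e, AddCircle.toCircle_add]

theorem e_zero : e 0 = 1 := by simp [e]

theorem e_neg (x : UnitAddCircle) : e (-x) = starRingEnd ℂ (e x) := by
  rw [e, e, AddCircle.toCircle_neg, Circle.coe_inv_eq_conj]

theorem norm_e (x : UnitAddCircle) : ‖e x‖ = 1 := Circle.norm_coe _

theorem continuous_e : Continuous e :=
  continuous_subtype_val.comp AddCircle.continuous_toCircle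

theorem e_sub_mul (x y : UnitAddCircle) : e x - e y = e y * (e (x - y) - 1) := by
  rw [mul_sub, ← e_add]; simp

theorem exists_abs_eq_norm (a : UnitAddCircle) :
    ∃ r : ℝ, (r : UnitAddCircle) = a ∧ |r| = ‖a‖ ∧ |r| ≤ 1 / 2 := by
  obtain ⟨x, rfl⟩ := QuotientAddGroup.mk_surjective a
  refine ⟨x - round x, ?_, ?_, abs_sub_round x⟩
  · have : ((round x : ℝ) : UnitAddCircle) = 0 := by
      rw [AddCircle.coe_eq_zero_iff]
      exact ⟨round x, by simp⟩
    rw [AddCircle.coe_sub, this, sub_zero]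
  · exact UnitAddCircle.norm_eq.symm

theorem norm_e_coe_sub_one (r : ℝ) : ‖e (r : UnitAddCircle) - 1‖ = 2 * |Real.sin (Real.pi * r)| := by
  have := Complex.norm_exp_I_mul_ofReal_sub_one (2 * Real.pi * r)
  rw [e_coe, show (2 * Real.pi * Complex.I * r : ℂ) = Complex.I * (2 * Real.pi * r : ℝ) by
    push_cast; ring, this, Real.norm_eq_abs, abs_mul, abs_two]
  congr 3
  ring

theorem four_mul_norm_le (a : UnitAddCircle) : 4 * ‖a‖ ≤ ‖e a - 1‖ := by
  obtain ⟨r, rfl, hr, hr2⟩ := exists_abs_eq_norm a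
  rw [norm_e_coe_sub_one, ← hr]
  have h1 := Real.mul_abs_le_abs_sin (x := Real.pi * r) (by
    rw [abs_mul, abs_of_pos Real.pi_pos]; nlinarith [Real.pi_pos])
  rw [abs_mul, abs_of_pos Real.pi_pos, ← mul_assoc, div_mul_cancel₀ _ Real.pi_ne_zero] at h1
  linarith

theorem norm_e_sub_one_le (a : UnitAddCircle) : ‖e a - 1‖ ≤ 2 * Real.pi * ‖a‖ := by
  obtain ⟨r, rfl, hr, hr2⟩ := exists_abs_eq_norm a
  rw [norm_e_coe_sub_one, ← hr]
  have h1 := Real.abs_sin_le_abs (x := Real.pi * r)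
  rw [abs_mul, abs_of_pos Real.pi_pos] at h1
  linarith

theorem norm_e_sub_e_le (a b : UnitAddCircle) : ‖e a - e b‖ ≤ 8 * ‖a - b‖ := by
  rw [e_sub_mul, norm_mul, norm_e, one_mul]
  refine (norm_e_sub_one_le _).trans ?_
  have := Real.pi_lt_four
  gcongr
  linarith

theorem four_mul_norm_sub_le (a b : UnitAddCircle) : 4 * ‖a - b‖ ≤ ‖e a - e b‖ := by
  rw [e_sub_mul, norm_mul, norm_e, one_mul]
  exact four_mul_norm_le _

/-- The argument of a complex number, as an element of `ℝ/ℤ`. -/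
noncomputable def circleArg (z : ℂ) : UnitAddCircle := (Complex.arg z / (2 * Real.pi) : ℝ)

theorem measurable_circleArg : Measurable circleArg :=
  (AddCircle.measurable_mk' (a := 1)).comp (Complex.measurable_arg.div_const _)

theorem norm_mul_e_circleArg (z : ℂ) : ‖z‖ * e (circleArg z) = z := by
  rw [circleArg, e_coe]
  convert Complex.norm_mul_exp_arg_mul_I z using 3
  push_cast
  have : (Real.pi : ℂ) ≠ 0 := by exact_mod_cast Real.pi_ne_zero
  field_simp

theorem norm_e_circleArg_sub (z : ℂ) (hz : ‖z‖ ≤ 1) : ‖e (circleArg z) - z‖ = 1 - ‖z‖ := by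
  have : e (circleArg z) - z = ((1 - ‖z‖ : ℝ) : ℂ) * e (circleArg z) := by
    conv_lhs => rw [← norm_mul_e_circleArg z]
    have h := norm_mul_e_circleArg z
    rw [h]; push_cast; rw [sub_mul, h, one_mul]
  rw [this, norm_mul, norm_e, mul_one, Complex.norm_real, Real.norm_eq_abs, abs_of_nonneg]
  linarith

/-- The mean of a circle-valued random variable is close to it on average, if two independent copies
are close to each other on average. -/
theorem lintegral_enorm_sub_circleArg_le {Ω : Type*} [MeasurableSpace Ω] (ν : Measure Ω)
    [IsProbabilityMeasure ν] {u : Ω → UnitAddCircle} (hu : Measurable u) :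
    ∫⁻ s, ‖u s - circleArg (∫ t, e (u t) ∂ν)‖ₑ ∂ν ≤
      4 * ∫⁻ s, ∫⁻ t, ‖u s - u t‖ₑ ∂ν ∂ν := by
  have hint : Integrable (fun t => e (u t)) ν :=
    Integrable.of_bound (continuous_e.measurable.comp hu).aestronglyMeasurable 1
      (ae_of_all _ fun t => (norm_e _).le)
  set z := ∫ t, e (u t) ∂ν with hz
  have hz1 : ‖z‖ ≤ 1 := by
    refine (norm_integral_le_of_norm_le_const (C := 1) (ae_of_all _ fun t => (norm_e _).le)).trans ?_
    simp
  rw [← lintegral_const_mul' _ _ (by simp)]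
  refine lintegral_mono fun s => ?_
  -- Radial projection moves `z` by `1 - ‖z‖`, which is at most its distance to the point `e (u s)`
  -- of the circle. The bound also covers `z = 0`, where any argument will do.
  have h1 : ‖u s - circleArg z‖ ≤ 1 / 2 * ‖e (u s) - z‖ := by
    have a := four_mul_norm_sub_le (u s) (circleArg z)
    have b := norm_sub_le_norm_sub_add_norm_sub (e (u s)) z (e (circleArg z))
    rw [norm_sub_rev z, norm_e_circleArg_sub z hz1] at b
    have c := norm_sub_norm_le (e (u s)) z
    rw [norm_e] at c
    linarith
  have h2 : e (u s) - z = ∫ t, (e (u s) - e (u t)) ∂ν := by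
    rw [integral_sub (integrable_const _) hint]; simp [hz]
  have h3 : ENNReal.ofReal ‖e (u s) - z‖ ≤ 8 * ∫⁻ t, ‖u s - u t‖ₑ ∂ν := by
    rw [ofReal_norm, h2]
    refine (enorm_integral_le_lintegral_enorm _).trans ?_
    rw [← lintegral_const_mul' _ _ (by simp)]
    refine lintegral_mono fun t => ?_
    rw [← ofReal_norm, ← ofReal_norm]
    refine (ENNReal.ofReal_le_ofReal (norm_e_sub_e_le _ _)).trans ?_
    rw [ENNReal.ofReal_mul (by norm_num)]
    simp
  calc ‖u s - circleArg z‖ₑ = ENNReal.ofReal ‖u s - circleArg z‖ := (ofReal_norm _).symm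
    _ ≤ ENNReal.ofReal (1 / 2 * ‖e (u s) - z‖) := ENNReal.ofReal_le_ofReal h1
    _ = ENNReal.ofReal (1 / 2) * ENNReal.ofReal ‖e (u s) - z‖ := ENNReal.ofReal_mul (by norm_num)
    _ ≤ ENNReal.ofReal (1 / 2) * (8 * ∫⁻ t, ‖u s - u t‖ₑ ∂ν) := by gcongr
    _ = _ := by
      rw [← mul_assoc]
      congr 1
      rw [show (8 : ENNReal) = ENNReal.ofReal 8 by simp, ← ENNReal.ofReal_mul (by norm_num)]
      norm_num

/-- The representative in `(-1/2, 1/2]` of an element of `ℝ/ℤ`. -/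
noncomputable def lift (a : UnitAddCircle) : ℝ := (AddCircle.equivIoc 1 (-(1 / 2)) a : ℝ)

theorem measurable_lift : Measurable lift :=
  measurable_subtype_coe.comp (AddCircle.measurableEquivIoc 1 (-(1 / 2))).measurable

theorem coe_lift (a : UnitAddCircle) : (lift a : UnitAddCircle) = a :=
  (AddCircle.equivIoc 1 (-(1 / 2))).symm_apply_apply a

theorem abs_lift (a : UnitAddCircle) : |lift a| = ‖a‖ := by
  have h := (AddCircle.equivIoc 1 (-(1 / 2)) a).2
  conv_rhs => rw [← coe_lift a]
  refine ((AddCircle.norm_coe_eq_abs_iff (p := 1) one_ne_zero).2 ?_).symm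
  rw [abs_le, abs_one]
  constructor
  · exact h.1.le
  · have := h.2
    unfold lift
    linarith

/-- This turns identities modulo 1 into identities between small real lifts. -/
theorem eq_of_coe_eq {r s : ℝ} (h : (r : UnitAddCircle) = s) (hr : |r| < 1 / 2) (hs : |s| < 1 / 2) :
    r = s := by
  have h0 : ((r - s : ℝ) : UnitAddCircle) = 0 := by rw [AddCircle.coe_sub, h, sub_self]
  obtain ⟨n, hn⟩ := (AddCircle.coe_eq_zero_iff (p := (1 : ℝ))).1 h0
  have hn' : (n : ℝ) = r - s := by simpa using hn
  have h1 : |(n : ℝ)| < 1 := by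
    rw [hn']; exact (abs_sub _ _).trans_lt (by linarith)
  have : n = 0 := by
    rw [← Int.abs_lt_one_iff]; exact_mod_cast h1
  rw [this] at hn'
  simp at hn'
  linarith

end Circle

end Gowers

namespace Gowers

/-! ### From differences small on average to differences small everywhere -/

section Correction

variable {G : Type*} [AddCommGroup G] [MeasurableSpace G] [MeasurableSub₂ G] [MeasurableAdd₂ G]
  [MeasurableNeg G] (μ : Measure G) [IsProbabilityMeasure μ] [μ.IsAddLeftInvariant]
  [μ.IsNegInvariant]

/-- If the iterated differences of `φ` are small on average, then `φ` can be modified by a function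
that is small on average in such a way that all iterated differences become small. -/
theorem exists_uniform_correction (k : ℕ) {φ : G → UnitAddCircle} (hφ : Measurable φ)
    {D : ENNReal} (hD : ∫⁻ h : Fin k → G, ∫⁻ x, ‖iterDiff k h φ x‖ₑ ∂μ ∂(Measure.pi fun _ => μ) ≤ D) :
    ∃ R : G → UnitAddCircle, Measurable R ∧ ∫⁻ x, ‖R x‖ₑ ∂μ ≤ 9 * 2 ^ k * D ∧
      ∀ h x, ‖iterDiff k h (fun y => φ y - ((-1 : ℤ) ^ k) • R y) x‖ₑ ≤ 34 * (2 ^ k) ^ 4 * D := by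
  set ν := Measure.pi fun _ : Fin k => μ with hν
  set s : ℤ := (-1) ^ k with hs
  have hss : ∀ a : UnitAddCircle, s • s • a = a := fun a => by
    rw [smul_smul, hs, ← mul_pow]; simp
  have hN : (1 : ENNReal) ≤ 2 ^ k := one_le_pow₀ (by norm_num)
  have hmΔ : Measurable fun p : (Fin k → G) × G => iterDiff k p.1 φ p.2 :=
    measurable_iterDiff hφ (by fun_prop) (by fun_prop)
  have hmΔh : ∀ h, Measurable (iterDiff k h φ) := fun h =>
    measurable_iterDiff hφ measurable_const measurable_id
  have hmx : ∀ {Q : G → UnitAddCircle}, Measurable Q → ∀ x,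
      Measurable fun h : Fin k → G => iterDiff k h Q x := fun hQ x =>
    measurable_iterDiff hQ measurable_id measurable_const
  -- Both `Δ_h φ(x)` and `Δ_t φ(x)` are close, up to the same sign, to the symmetric quantity `Δ_t
  -- Δ_h φ(x)`. The estimate holds at every `x`, not just almost every one.
  have hclose : ∀ x, ∫⁻ h, ∫⁻ t, ‖iterDiff k h φ x - iterDiff k t φ x‖ₑ ∂ν ∂ν ≤
      2 * 2 ^ k * D := fun x => by
    have hm2 : Measurable fun p : (Fin k → G) × (Fin k → G) =>
        iterDiff k p.2 (iterDiff k p.1 φ) x :=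
      (measurable_iterDiff_param k (A := Fin k → G) (Q := fun h => iterDiff k h φ) hmΔ).comp
        (f := fun p : (Fin k → G) × (Fin k → G) => ((p.1, x), p.2)) (by fun_prop)
    have hmA : Measurable fun p : (Fin k → G) × (Fin k → G) =>
        iterDiff k p.2 (iterDiff k p.1 φ) x - s • iterDiff k p.1 φ x :=
      hm2.sub (((hmx hφ x).comp measurable_fst).const_smul s)
    have hmB : Measurable fun p : (Fin k → G) × (Fin k → G) =>
        iterDiff k p.1 (iterDiff k p.2 φ) x - s • iterDiff k p.2 φ x := hmA.comp measurable_swap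
    have hA : ∫⁻ h, ∫⁻ t, ‖iterDiff k t (iterDiff k h φ) x - s • iterDiff k h φ x‖ₑ ∂ν ∂ν ≤
        2 ^ k * D := by
      calc _ ≤ ∫⁻ h, 2 ^ k * ∫⁻ y, ‖iterDiff k h φ y‖ₑ ∂μ ∂ν :=
            lintegral_mono fun h => lintegral_enorm_iterDiff_sub_le μ k (hmΔh h) x
        _ ≤ _ := by
          rw [lintegral_const_mul' _ _ (by simp)]
          gcongr
    calc _ ≤ ∫⁻ h, ∫⁻ t, (‖iterDiff k t (iterDiff k h φ) x - s • iterDiff k h φ x‖ₑ +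
          ‖iterDiff k h (iterDiff k t φ) x - s • iterDiff k t φ x‖ₑ) ∂ν ∂ν := by
          refine lintegral_mono fun h => lintegral_mono fun t => ?_
          rw [add_comm, ← enorm_neg_one_pow_zsmul k, ← hs, iterDiff_comm k k t h]
          refine le_trans (le_of_eq ?_) enorm_sub_le
          congr 1
          rw [smul_sub]; abel
      _ = ∫⁻ h, ∫⁻ t, ‖iterDiff k t (iterDiff k h φ) x - s • iterDiff k h φ x‖ₑ ∂ν ∂ν +
          ∫⁻ h, ∫⁻ t, ‖iterDiff k h (iterDiff k t φ) x - s • iterDiff k t φ x‖ₑ ∂ν ∂ν := by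
          have : ∀ h, Measurable fun t =>
              ‖iterDiff k t (iterDiff k h φ) x - s • iterDiff k h φ x‖ₑ := fun h =>
            hmA.enorm.comp (f := fun t => (h, t)) (by fun_prop)
          simp_rw [lintegral_add_left (this _)]
          rw [lintegral_add_left hmA.enorm.lintegral_prod_right']
      _ ≤ 2 ^ k * D + 2 ^ k * D := by
          refine add_le_add hA ?_
          rw [lintegral_lintegral_swap hmB.enorm.aemeasurable]
          exact hA
      _ = _ := by ring
  -- The circular mean over `h` serves as the common value of the `Δ_h φ(x)`.
  set R : G → UnitAddCircle := fun x => circleArg (∫ h, e (iterDiff k h φ x) ∂ν)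
  have hRm : Measurable R := by
    refine measurable_circleArg.comp ?_
    exact (StronglyMeasurable.integral_prod_left (f := fun (h : Fin k → G) (x : G) =>
      e (iterDiff k h φ x)) (continuous_e.measurable.comp hmΔ).stronglyMeasurable).measurable
  have hR1 : ∀ x, ∫⁻ h, ‖iterDiff k h φ x - R x‖ₑ ∂ν ≤ 8 * 2 ^ k * D := fun x => by
    refine (lintegral_enorm_sub_circleArg_le ν (hmx hφ x)).trans ?_
    refine (mul_le_mul_right (hclose x) 4).trans (le_of_eq ?_)
    ring
  have hR2 : ∫⁻ x, ‖R x‖ₑ ∂μ ≤ 9 * 2 ^ k * D := by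
    calc ∫⁻ x, ‖R x‖ₑ ∂μ = ∫⁻ x, ∫⁻ _h, ‖R x‖ₑ ∂ν ∂μ := by simp
      _ ≤ ∫⁻ x, ∫⁻ h, (‖iterDiff k h φ x - R x‖ₑ + ‖iterDiff k h φ x‖ₑ) ∂ν ∂μ := by
          refine lintegral_mono fun x => lintegral_mono fun h => ?_
          rw [add_comm]
          refine le_trans (le_of_eq ?_) enorm_sub_le
          congr 1; abel
      _ = ∫⁻ x, ∫⁻ h, ‖iterDiff k h φ x - R x‖ₑ ∂ν ∂μ +
            ∫⁻ x, ∫⁻ h, ‖iterDiff k h φ x‖ₑ ∂ν ∂μ := by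
          simp_rw [fun x => lintegral_add_right (μ := ν) (fun h => ‖iterDiff k h φ x - R x‖ₑ)
            (hmx hφ x).enorm]
          have hm : Measurable fun x => ∫⁻ h, ‖iterDiff k h φ x‖ₑ ∂ν :=
            (hmΔ.comp measurable_swap).enorm.lintegral_prod_right'
          rw [lintegral_add_right _ hm]
      _ ≤ 8 * 2 ^ k * D + 2 ^ k * D := by
          refine add_le_add ((lintegral_mono hR1).trans (by simp)) ?_
          rw [lintegral_lintegral_swap (hmΔ.comp measurable_swap).enorm.aemeasurable]
          exact hD.trans (le_mul_of_one_le_left' hN)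
      _ = _ := by ring
  refine ⟨R, hRm, hR2, ?_⟩
  set F : G → UnitAddCircle := fun y => φ y - s • R y with hF
  have hFm : Measurable F := hφ.sub (hRm.const_smul s)
  -- `Δ_t φ(x)` is near `R(x)` and `s • Δ_t R(x)` is near `s • s • R(x) = R(x)`, so the two cancel:
  -- every point, average direction.
  have hF1 : ∀ x, ∫⁻ t, ‖iterDiff k t F x‖ₑ ∂ν ≤ 17 * (2 ^ k) ^ 2 * D := fun x => by
    calc ∫⁻ t, ‖iterDiff k t F x‖ₑ ∂ν
        ≤ ∫⁻ t, (‖iterDiff k t φ x - R x‖ₑ + ‖iterDiff k t R x - s • R x‖ₑ) ∂ν := by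
          refine lintegral_mono fun t => ?_
          rw [hF, iterDiff_sub, iterDiff_zsmul,
            ← enorm_neg_one_pow_zsmul k (iterDiff k t R x - s • R x), ← hs, smul_sub, hss]
          refine le_trans (le_of_eq ?_) enorm_sub_le
          congr 1; abel
      _ ≤ 8 * 2 ^ k * D + 2 ^ k * (9 * 2 ^ k * D) := by
          rw [lintegral_add_left ((hmx hφ x).sub_const _).enorm]
          refine add_le_add (hR1 x) ((lintegral_enorm_iterDiff_sub_le μ k hRm x).trans ?_)
          gcongr
      _ ≤ 8 * (2 ^ k * 2 ^ k) * D + 2 ^ k * (9 * 2 ^ k * D) := by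
          gcongr
          exact le_mul_of_one_le_left' hN
      _ = _ := by ring
  have hmF : Measurable fun p : (Fin k → G) × G => iterDiff k p.1 F p.2 :=
    measurable_iterDiff hFm (by fun_prop) (by fun_prop)
  -- The complementary regime: every direction, average point.
  have hF2 : ∀ h, ∫⁻ y, ‖iterDiff k h F y‖ₑ ∂μ ≤ 2 ^ k * (17 * (2 ^ k) ^ 2 * D) := fun h => by
    refine (lintegral_enorm_iterDiff_le_lintegral_pi μ k h hFm).trans ?_
    gcongr
    rw [lintegral_lintegral_swap hmF.enorm.aemeasurable]
    exact (lintegral_mono hF1).trans (by simp)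
  intro h x
  have hFh : Measurable (iterDiff k h F) := measurable_iterDiff hFm measurable_const measurable_id
  -- Compare `Δ_h F(x)` with `Δ_t Δ_h F(x)` for random `t`: `hF2` bounds the discrepancy, and `hF1`
  -- bounds `Δ_h (Δ_t F)(x)` vertex by vertex.
  calc ‖iterDiff k h F x‖ₑ = ∫⁻ _t : Fin k → G, ‖iterDiff k h F x‖ₑ ∂ν := by simp
    _ ≤ ∫⁻ t, (‖iterDiff k t (iterDiff k h F) x - s • iterDiff k h F x‖ₑ +
          ‖iterDiff k h (iterDiff k t F) x‖ₑ) ∂ν := by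
        refine lintegral_mono fun t => ?_
        rw [← enorm_neg_one_pow_zsmul k, ← hs, add_comm, iterDiff_comm k k t h]
        refine le_trans (le_of_eq ?_) enorm_sub_le
        congr 1; abel
    _ ≤ 2 ^ k * (2 ^ k * (17 * (2 ^ k) ^ 2 * D)) + 2 ^ k * (17 * (2 ^ k) ^ 2 * D) := by
        rw [lintegral_add_left ((hmx hFh x).sub_const _).enorm]
        refine add_le_add ((lintegral_enorm_iterDiff_sub_le μ k hFh x).trans ?_) ?_
        · gcongr
          exact hF2 h
        · exact lintegral_enorm_iterDiff_param_le ν k h (fun y => hmx hFm y) hF1 x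
    _ ≤ 2 ^ k * (2 ^ k * (17 * (2 ^ k) ^ 2 * D)) + 2 ^ k * (2 ^ k * (17 * (2 ^ k) ^ 2 * D)) := by
        refine add_le_add_right (mul_le_mul_right ?_ _) _
        exact le_mul_of_one_le_left' hN
    _ = _ := by ring

end Correction

/-! ### From uniformly small differences to an exact polynomial -/

section Integration

theorem iterDiff_integral {A G : Type*} [MeasurableSpace A] (ν : Measure A) [AddCommGroup G]
    (m : ℕ) (h : Fin m → G) {Q : A → G → ℝ} (hQ : ∀ y, Integrable (fun a => Q a y) ν) (x : G) :
    iterDiff m h (fun y => ∫ a, Q a y ∂ν) x = ∫ a, iterDiff m h (Q a) x ∂ν := by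
  have hi : ∀ (m : ℕ) (h : Fin m → G) (x : G), Integrable (fun a => iterDiff m h (Q a) x) ν := by
    intro m
    induction m with
    | zero => exact fun _ => hQ
    | succ m ih => exact fun h x => (ih _ _).sub (ih _ _)
  induction m generalizing x with
  | zero => rfl
  | succ m ih =>
    simp only [iterDiff, diff, ih]
    rw [integral_sub (hi _ _ _) (hi _ _ _)]

theorem eq_zero_of_additive_of_bounded {G : Type*} [AddCommGroup G] {f : G → ℝ}
    (hf : ∀ a b, f (a + b) = f a + f b) {C : ℝ} (hC : ∀ a, |f a| ≤ C) (a : G) : f a = 0 := by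
  have hn : ∀ n : ℕ, f (n • a) = n * f a := by
    intro n
    have := map_nsmul (AddMonoidHom.mk' f hf) n a
    simpa using this
  by_contra h
  obtain ⟨n, hn1⟩ := exists_nat_gt (C / |f a|)
  have h1 := hC (n • a)
  rw [hn, abs_mul, Nat.abs_cast] at h1
  rw [div_lt_iff₀ (abs_pos.2 h)] at hn1
  linarith

variable {G : Type*} [AddCommGroup G] [MeasurableSpace G] [MeasurableSub₂ G] [MeasurableAdd₂ G]
  [MeasurableNeg G] (μ : Measure G) [IsProbabilityMeasure μ] [μ.IsAddLeftInvariant]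
  [μ.IsNegInvariant]

/-- Averaging `Δ_a` over `a` turns a function into its mean minus itself, and further differences
kill the mean. At least one difference is needed for the mean to appear. -/
theorem integral_iterDiff_succ (m : ℕ) {q : G → ℝ} (hq : Measurable q) {C : ℝ}
    (hC : ∀ x, ‖q x‖ ≤ C) (x : G) :
    ∫ h : Fin (m + 1) → G, iterDiff (m + 1) h q x ∂(Measure.pi fun _ => μ) =
      (-1) ^ (m + 1) * (q x - ∫ y, q y ∂μ) := by
  have hi : ∀ m x, Integrable (fun h : Fin m → G => iterDiff m h q x)
      (Measure.pi fun _ => μ) := fun m x =>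
    Integrable.of_bound (measurable_iterDiff hq (by fun_prop) (by fun_prop)).aestronglyMeasurable
      (2 ^ m * C) (ae_of_all _ fun h => norm_iterDiff_le m h hC x)
  have hqi' : ∀ x, Integrable (fun a => q (x - a)) μ := fun x =>
    Integrable.of_bound (hq.comp (measurable_id.const_sub x)).aestronglyMeasurable C
      (ae_of_all _ fun a => hC _)
  induction m generalizing x with
  | zero =>
    rw [integral_pi_succ μ 0 (hi _ x)]
    simp_rw [iterDiff_cons, diff]
    simp only [iterDiff, integral_const, probReal_univ, one_smul]
    rw [integral_sub (hqi' x) (integrable_const _), integral_sub_left_eq_self q]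
    simp
  | succ m ih =>
    rw [integral_pi_succ μ (m + 1) (hi _ x)]
    simp_rw [iterDiff_cons, diff, integral_sub (hi _ _) (hi _ _), ih, ← mul_sub,
      sub_sub_sub_cancel_right]
    rw [integral_const_mul, integral_sub (hqi' x) (integrable_const _),
      integral_sub_left_eq_self q]
    simp only [integral_const, probReal_univ, one_smul]
    ring

include μ in
/-- A function all of whose iterated differences are uniformly small is uniformly close to one whose
iterated differences vanish. -/
theorem exists_iterDiff_eq_zero (m : ℕ) {F : G → UnitAddCircle} (hF : Measurable F) {δ : ℝ}
    (hδ : 2 ^ (m + 1) * δ < 1 / 2) (hFδ : ∀ h x, ‖iterDiff (m + 1) h F x‖ ≤ δ) :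
    ∃ ψ : G → UnitAddCircle, Measurable ψ ∧ (∀ x, ‖ψ x‖ ≤ δ) ∧
      ∀ h x, iterDiff (m + 1) h (fun y => F y - ψ y) x = 0 := by
  set ν := Measure.pi fun _ : Fin (m + 1) => μ with hν
  set c : (Fin (m + 1) → G) → G → ℝ := fun h x => lift (iterDiff (m + 1) h F x) with hc
  have hcδ : ∀ h x, ‖c h x‖ ≤ δ := fun h x => by
    rw [Real.norm_eq_abs, hc, abs_lift]; exact hFδ h x
  have hδ0 : 0 ≤ δ := (norm_nonneg _).trans (hFδ 0 0)
  have h2δ : 2 * δ < 1 / 2 := by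
    refine lt_of_le_of_lt ?_ hδ
    gcongr
    rw [pow_succ]
    linarith [one_le_pow₀ (M₀ := ℝ) (a := 2) (n := m) (by norm_num)]
  have hcm : Measurable fun p : (Fin (m + 1) → G) × G => c p.1 p.2 :=
    measurable_lift.comp (measurable_iterDiff hF (by fun_prop) (by fun_prop))
  have hcm1 : ∀ h, Measurable (c h) := fun h =>
    hcm.comp (f := fun x => (h, x)) (by fun_prop)
  have hcm2 : ∀ x, Measurable fun h => c h x := fun x =>
    hcm.comp (f := fun h => (h, x)) (by fun_prop)
  have hci : ∀ x, Integrable (fun h => c h x) ν := fun x =>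
    Integrable.of_bound (hcm2 x).aestronglyMeasurable δ (ae_of_all _ fun h => hcδ h x)
  have hci1 : ∀ h, Integrable (c h) μ := fun h =>
    Integrable.of_bound (hcm1 h).aestronglyMeasurable δ (ae_of_all _ fun x => hcδ h x)
  set π : ℝ →+ UnitAddCircle := QuotientAddGroup.mk' (AddSubgroup.zmultiples (1 : ℝ))
  have hπc : ∀ r : ℝ, π r = (r : UnitAddCircle) := fun _ => rfl
  have hcπ : ∀ h x, π (c h x) = iterDiff (m + 1) h F x := fun h x => coe_lift _
  -- Commutation of differences gives this modulo 1; both sides have size at most `2 ^ (m + 1) * δ <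
  -- 1 / 2`.
  have hsymm : ∀ h t x, iterDiff (m + 1) t (c h) x = iterDiff (m + 1) h (c t) x := by
    intro h t x
    refine eq_of_coe_eq ?_ ?_ ?_
    · rw [← hπc, ← hπc, ← iterDiff_map, ← iterDiff_map]
      simp_rw [hcπ]
      exact congrFun (iterDiff_comm _ _ t h F) x
    · exact (norm_iterDiff_le _ t (hcδ h) x).trans_lt hδ
    · exact (norm_iterDiff_le _ h (hcδ t) x).trans_lt hδ
  -- The relation `Δ_{a+b} Q(x) = Δ_a Q(x) + Δ_b Q(x-a)` lifts to the reals because `2 * δ < 1 / 2`.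
  -- By invariance the mean is additive in the first direction; being bounded, it vanishes.
  have hmean : ∀ t, ∫ x, c t x ∂μ = 0 := by
    intro t
    rw [← Fin.cons_self_tail t]
    refine eq_zero_of_additive_of_bounded
      (f := fun a => ∫ x, c (Fin.cons a (Fin.tail t) : Fin (m + 1) → G) x ∂μ) ?_ (C := δ) ?_ (t 0)
    · intro a b
      have hadd : ∀ x, c (Fin.cons (a + b) (Fin.tail t) : Fin (m + 1) → G) x =
          c (Fin.cons a (Fin.tail t) : Fin (m + 1) → G) x +
            c (Fin.cons b (Fin.tail t) : Fin (m + 1) → G) (x - a) := by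
        intro x
        refine eq_of_coe_eq ?_ ?_ ?_
        · rw [← hπc, ← hπc, map_add, hcπ, hcπ, hcπ, iterDiff_cons, iterDiff_cons, iterDiff_cons]
          simp only [diff, sub_sub]
          abel
        · exact (hcδ _ _).trans_lt (by linarith)
        · refine (abs_add_le _ _).trans_lt ?_
          have h1 := hcδ (Fin.cons a (Fin.tail t) : Fin (m + 1) → G) x
          have h2 := hcδ (Fin.cons b (Fin.tail t) : Fin (m + 1) → G) (x - a)
          rw [Real.norm_eq_abs] at h1 h2
          linarith
      simp_rw [hadd]
      rw [integral_add (hci1 _) ((hci1 _).comp_sub_right a), integral_sub_right_eq_self (c _)]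
    · intro a
      exact (norm_integral_le_of_norm_le_const (ae_of_all _ (hcδ _))).trans (by simp)
  set ψ : G → ℝ := fun x => ∫ h, c h x ∂ν with hψ
  have hψm : Measurable ψ :=
    (StronglyMeasurable.integral_prod_left (f := c) hcm.stronglyMeasurable).measurable
  have hψδ : ∀ x, |ψ x| ≤ δ := fun x =>
    (norm_integral_le_of_norm_le_const (ae_of_all _ fun h => hcδ h x)).trans (by simp)
  -- Symmetry replaces the mean over `h` of `Δ_t c_h` by that of `Δ_h c_t`, which recovers `c_t` up
  -- to sign since `c_t` has mean zero.
  have hψd : ∀ t x, iterDiff (m + 1) t ψ x = (-1) ^ (m + 1) * c t x := by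
    intro t x
    rw [hψ, iterDiff_integral ν _ t hci x]
    simp_rw [hsymm]
    rw [hν, integral_iterDiff_succ μ m (hcm1 t) (hcδ t) x, hmean, sub_zero]
  refine ⟨fun x => π ((-1) ^ (m + 1) * ψ x), ?_, ?_, ?_⟩
  · exact (AddCircle.measurable_mk' (a := 1)).comp (hψm.const_mul _)
  · intro x
    have h1 : |(-1) ^ (m + 1) * ψ x| ≤ δ := by
      rw [abs_mul, abs_pow]; simpa using hψδ x
    change ‖π ((-1) ^ (m + 1) * ψ x)‖ ≤ δ
    rw [hπc, (AddCircle.norm_coe_eq_abs_iff (p := 1) one_ne_zero).2]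
    · exact h1
    · rw [abs_one]; linarith
  · intro h x
    rw [iterDiff_sub, iterDiff_map]
    have : iterDiff (m + 1) h (fun y => (-1) ^ (m + 1) * ψ y) x = c h x := by
      have := iterDiff_map (m + 1) h (AddMonoidHom.mulLeft ((-1 : ℝ) ^ (m + 1))) ψ x
      simp only [AddMonoidHom.coe_mulLeft] at this
      rw [this, hψd, ← mul_assoc, ← mul_pow]
      simp
    rw [this, hcπ, sub_self]

/-- A circle-valued function whose iterated differences are small on average is close to a
polynomial. -/
theorem exists_isPolynomialDegLT (k : ℕ) (hk : 1 ≤ k) {φ : G → UnitAddCircle} (hφ : Measurable φ)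
    {δ : ℝ} (hδ0 : 0 ≤ δ) (hδ : 68 * (2 ^ k) ^ 5 * δ < 1)
    (hD : ∫⁻ h : Fin k → G, ∫⁻ x, ‖iterDiff k h φ x‖ₑ ∂μ ∂(Measure.pi fun _ => μ) ≤
      ENNReal.ofReal δ) :
    ∃ P : G → UnitAddCircle, IsPolynomialDegLT μ k P ∧
      ∫⁻ x, ‖φ x - P x‖ₑ ∂μ ≤ ENNReal.ofReal (43 * (2 ^ k) ^ 4 * δ) := by
  obtain ⟨m, rfl⟩ : ∃ m, k = m + 1 := ⟨k - 1, by omega⟩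
  obtain ⟨R, hRm, hR, hRΔ⟩ := exists_uniform_correction μ (m + 1) hφ hD
  set N : ℝ := 2 ^ (m + 1) with hN
  have hN1 : 1 ≤ N := one_le_pow₀ (by norm_num)
  have hNe : (2 ^ (m + 1) : ENNReal) = ENNReal.ofReal N := by
    rw [hN, ENNReal.ofReal_pow (by norm_num)]; simp
  have hR' : ∫⁻ x, ‖R x‖ₑ ∂μ ≤ ENNReal.ofReal (9 * N * δ) := by
    refine hR.trans (le_of_eq ?_)
    rw [hNe, ENNReal.ofReal_mul (by positivity), ENNReal.ofReal_mul (by positivity)]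
    simp
  have hRΔ' : ∀ h x, ‖iterDiff (m + 1) h (fun y => φ y - ((-1 : ℤ) ^ (m + 1)) • R y) x‖ ≤
      34 * N ^ 4 * δ := fun h x => by
    rw [← ENNReal.ofReal_le_ofReal_iff (by positivity), ofReal_norm]
    refine (hRΔ h x).trans (le_of_eq ?_)
    rw [hNe, ENNReal.ofReal_mul (by positivity), ENNReal.ofReal_mul (by positivity),
      ENNReal.ofReal_pow (p := N) (by positivity), ENNReal.ofReal_ofNat]
  have hFm : Measurable fun y => φ y - ((-1 : ℤ) ^ (m + 1)) • R y :=
    hφ.sub (hRm.const_smul ((-1 : ℤ) ^ (m + 1)))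
  -- The no-wraparound condition `N * (34 * N ^ 4 * δ) < 1 / 2` is exactly the assumed `68 * N ^ 5 *
  -- δ < 1`.
  obtain ⟨ψ, hψm, hψ, hψ0⟩ := exists_iterDiff_eq_zero μ m hFm
    (δ := 34 * N ^ 4 * δ) (by rw [← hN]; linarith) hRΔ'
  refine ⟨_, ⟨hFm.sub hψm, ae_of_all _ fun z => hψ0 _ _⟩, ?_⟩
  calc _ ≤ ∫⁻ x, (‖R x‖ₑ + ENNReal.ofReal (34 * N ^ 4 * δ)) ∂μ := by
        refine lintegral_mono fun x => ?_
        rw [← enorm_neg_one_pow_zsmul (m + 1) (R x)]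
        refine le_trans (le_of_eq ?_) ((enorm_add_le _ (ψ x)).trans (add_le_add_right ?_ _))
        · congr 1
          simp only [Pi.sub_apply]
          abel
        · rw [← ofReal_norm]
          exact ENNReal.ofReal_le_ofReal (hψ x)
    _ ≤ ENNReal.ofReal (9 * N * δ) + ENNReal.ofReal (34 * N ^ 4 * δ) := by
        rw [lintegral_add_left hRm.enorm]
        exact add_le_add hR' (by simp)
    _ ≤ _ := by
        rw [← ENNReal.ofReal_add (by positivity) (by positivity)]
        refine ENNReal.ofReal_le_ofReal ?_
        have : N ≤ N ^ 4 := le_self_pow₀ hN1 (by norm_num)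
        nlinarith

end Integration

end Gowers

namespace Gowers

/-! ### Gowers norms as averages over cubes -/

section Cube

variable {G : Type*} [AddCommGroup G]

/-- The multiplicative iterated difference of a complex-valued function. -/
noncomputable def cube : (m : ℕ) → (Fin m → G) → (G → ℂ) → G → ℂ
  | 0, _, f => f
  | m + 1, h, f => fun x =>
      cube m (fun i => h i.succ) f (x - h 0) * starRingEnd ℂ (cube m (fun i => h i.succ) f x)

/-- `uNorm` takes the new difference innermost and `cube` takes it outermost; this reconciles the
two recursions. -/
theorem cube_mul_conj (m : ℕ) (h : Fin m → G) (f : G → ℂ) (a x : G) :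
    cube m h (fun x => f (x - a) * starRingEnd ℂ (f x)) x =
      cube m h f (x - a) * starRingEnd ℂ (cube m h f x) := by
  induction m generalizing x with
  | zero => rfl
  | succ m ih =>
    simp only [cube, ih, map_mul, Complex.conj_conj]
    rw [sub_right_comm x (h 0) a]
    ring

/-- Keeping the factor at the base vertex, instead of bounding by 1, is what later shows that `‖f‖`
is near 1 on average. -/
theorem norm_cube_le (m : ℕ) (h : Fin m → G) {f : G → ℂ} (hf : ∀ x, ‖f x‖ ≤ 1) (x : G) :
    ‖cube m h f x‖ ≤ ‖f x‖ := by
  induction m generalizing x with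
  | zero => rfl
  | succ m ih =>
    simp only [cube, norm_mul, RCLike.norm_conj]
    exact (mul_le_of_le_one_left (norm_nonneg _) ((ih _ _).trans (hf _))).trans (ih _ _)

theorem cube_eq_norm_mul_e (m : ℕ) (h : Fin m → G) {f : G → ℂ} {φ : G → UnitAddCircle}
    (hf : ∀ x, f x = ‖f x‖ * e (φ x)) (x : G) :
    cube m h f x = ‖cube m h f x‖ * e (iterDiff m h φ x) := by
  induction m generalizing x with
  | zero => exact hf x
  | succ m ih =>
    simp only [cube, iterDiff, diff, norm_mul, RCLike.norm_conj]
    conv_lhs => rw [ih _ (x - h 0), ih _ x]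
    rw [sub_eq_add_neg (iterDiff m _ φ _), e_add, e_neg]
    simp only [map_mul, Complex.conj_ofReal]
    push_cast
    ring

variable [MeasurableSpace G]

theorem uNorm_nonneg (μ : Measure G) (k : ℕ) (f : G → ℂ) : 0 ≤ uNorm μ k f := by
  induction k generalizing f with
  | zero => exact le_rfl
  | succ k ih =>
    cases k with
    | zero => exact norm_nonneg _
    | succ k => exact Real.rpow_nonneg (integral_nonneg fun a => pow_nonneg (ih _) _) _

theorem uNorm_congr [MeasurableAdd₂ G] (μ : Measure G) [μ.IsAddLeftInvariant] (k : ℕ) {f g : G → ℂ}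
    (h : f =ᵐ[μ] g) : uNorm μ k f = uNorm μ k g := by
  induction k generalizing f g with
  | zero => rfl
  | succ k ih =>
    cases k with
    | zero => simp only [uNorm]; rw [integral_congr_ae h]
    | succ k =>
      simp only [uNorm]
      congr 2
      funext a
      rw [ih]
      have ha := (measurePreserving_sub_right μ a).quasiMeasurePreserving.ae_eq_comp h
      filter_upwards [ha, h] with x hx hx'
      simp only [Function.comp] at hx
      rw [hx, hx']

variable [MeasurableSub₂ G]

theorem measurable_cube {B : Type*} [MeasurableSpace B] {m : ℕ} {f : G → ℂ} (hf : Measurable f)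
    {u : B → Fin m → G} (hu : Measurable u) {v : B → G} (hv : Measurable v) :
    Measurable fun b => cube m (u b) f (v b) := by
  induction m generalizing v with
  | zero => exact hf.comp hv
  | succ m ih =>
    simp only [cube]
    exact (ih (by fun_prop) (by fun_prop)).mul
      (Complex.continuous_conj.measurable.comp (ih (by fun_prop) hv))

variable (μ : Measure G) [IsProbabilityMeasure μ]

variable [MeasurableAdd₂ G] [MeasurableNeg G] [μ.IsAddLeftInvariant] [μ.IsNegInvariant]

theorem uNorm_pow_eq_integral_integral (m : ℕ) {f : G → ℂ} (hf : Measurable f)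
    (hf1 : ∀ x, ‖f x‖ ≤ 1) :
    ((uNorm μ (m + 1) f ^ 2 ^ (m + 1) : ℝ) : ℂ) =
      ∫ h : Fin (m + 1) → G, ∫ x, cube (m + 1) h f x ∂μ ∂(Measure.pi fun _ => μ) := by
  have hcm : ∀ m, Measurable fun p : (Fin m → G) × G => cube m p.1 f p.2 := fun m =>
    measurable_cube hf (by fun_prop) (by fun_prop)
  have hci : ∀ m, Integrable (fun h : Fin m → G => ∫ x, cube m h f x ∂μ)
      (Measure.pi fun _ => μ) := fun m =>
    Integrable.of_bound (hcm m).stronglyMeasurable.integral_prod_right.aestronglyMeasurable 1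
      (ae_of_all _ fun h => (norm_integral_le_of_norm_le_const
        (ae_of_all _ fun x => (norm_cube_le m h hf1 x).trans (hf1 x))).trans (by simp))
  rw [integral_pi_succ μ m (hci _)]
  induction m generalizing f with
  | zero =>
    have hprod : Integrable (fun p : G × G => f (p.2 - p.1) * starRingEnd ℂ (f p.2))
        (μ.prod μ) := by
      refine Integrable.of_bound (Measurable.aestronglyMeasurable ?_) 1 (ae_of_all _ fun p => ?_)
      · exact (hf.comp (by fun_prop)).mul (Complex.continuous_conj.measurable.comp
          (hf.comp measurable_snd))
      · rw [norm_mul, RCLike.norm_conj]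
        exact mul_le_one₀ (hf1 _) (norm_nonneg _) (hf1 _)
    simp only [uNorm, cube, Fin.cons_zero, integral_const, probReal_univ, one_smul]
    rw [integral_integral_swap hprod]
    simp_rw [integral_mul_const, integral_sub_left_eq_self f, integral_const_mul]
    rw [integral_conj, RCLike.mul_conj]
    simp
  | succ m ih =>
    have hI : 0 ≤ ∫ h, uNorm μ (m + 1) (fun x => f (x - h) * starRingEnd ℂ (f x)) ^ 2 ^ (m + 1) ∂μ :=
      integral_nonneg fun a => pow_nonneg (uNorm_nonneg _ _ _) _
    have hpow : uNorm μ (m + 1 + 1) f ^ 2 ^ (m + 1 + 1) =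
        ∫ h, uNorm μ (m + 1) (fun x => f (x - h) * starRingEnd ℂ (f x)) ^ 2 ^ (m + 1) ∂μ := by
      conv_lhs => rw [uNorm]
      rw [← Real.rpow_natCast, ← Real.rpow_mul hI]
      push_cast
      rw [one_div_mul_cancel (by positivity), Real.rpow_one]
    rw [hpow, ← integral_complex_ofReal]
    refine integral_congr_ae (ae_of_all _ fun a => ?_)
    have hfa : Measurable fun x => f (x - a) * starRingEnd ℂ (f x) :=
      (hf.comp (by fun_prop)).mul (Complex.continuous_conj.measurable.comp hf)
    have hfa1 : ∀ x, ‖f (x - a) * starRingEnd ℂ (f x)‖ ≤ 1 := fun x => by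
      rw [norm_mul, RCLike.norm_conj]
      exact mul_le_one₀ (hf1 _) (norm_nonneg _) (hf1 _)
    have hcm' : ∀ m, Measurable fun p : (Fin m → G) × G =>
        cube m p.1 (fun x => f (x - a) * starRingEnd ℂ (f x)) p.2 := fun m =>
      measurable_cube hfa (by fun_prop) (by fun_prop)
    have hci' : ∀ m, Integrable (fun h : Fin m → G =>
        ∫ x, cube m h (fun x => f (x - a) * starRingEnd ℂ (f x)) x ∂μ)
        (Measure.pi fun _ => μ) := fun m =>
      Integrable.of_bound (hcm' m).stronglyMeasurable.integral_prod_right.aestronglyMeasurable 1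
        (ae_of_all _ fun h => (norm_integral_le_of_norm_le_const
          (ae_of_all _ fun x => (norm_cube_le m h hfa1 x).trans (hfa1 x))).trans (by simp))
    simp only
    rw [ih hfa hfa1 hcm' hci', ← integral_pi_succ μ m (hci' _)]
    simp_rw [cube_mul_conj]
    rfl

/-- The Gowers norm as an average over cubes. -/
theorem uNorm_pow_eq_integral (k : ℕ) (hk : 1 ≤ k) {f : G → ℂ} (hf : Measurable f)
    (hf1 : ∀ x, ‖f x‖ ≤ 1) :
    ((uNorm μ k f ^ 2 ^ k : ℝ) : ℂ) =
      ∫ z : G × (Fin k → G), cube k z.2 f z.1 ∂(μ.prod (Measure.pi fun _ => μ)) := by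
  obtain ⟨m, rfl⟩ : ∃ m, k = m + 1 := ⟨k - 1, by omega⟩
  rw [uNorm_pow_eq_integral_integral μ m hf hf1, integral_prod_symm]
  exact Integrable.of_bound (measurable_cube hf (by fun_prop) (by fun_prop)).aestronglyMeasurable 1
    (ae_of_all _ fun z => (norm_cube_le _ _ hf1 _).trans (hf1 _))

theorem uNorm_e_eq_one (k : ℕ) (hk : 1 ≤ k) {P : G → UnitAddCircle}
    (hP : IsPolynomialDegLT μ k P) : uNorm μ k (fun x => e (P x)) = 1 := by
  have h1 := uNorm_pow_eq_integral μ k hk (continuous_e.measurable.comp hP.1)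
    (fun x => (norm_e (P x)).le)
  have h2 : ∀ᵐ z : G × (Fin k → G) ∂(μ.prod (Measure.pi fun _ => μ)),
      cube k z.2 (e ∘ P) z.1 = 1 := by
    have hn : ∀ (m : ℕ) (h : Fin m → G) x, ‖cube m h (e ∘ P) x‖ = 1 := by
      intro m
      induction m with
      | zero => exact fun _ x => norm_e _
      | succ m ih => exact fun h x => by simp [cube, ih]
    filter_upwards [hP.2] with z hz
    rw [cube_eq_norm_mul_e k z.2 (φ := P) (fun x => by simp [norm_e]), hz, hn, e_zero]
    simp
  rw [integral_congr_ae h2] at h1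
  simp only [integral_const, probReal_univ, one_smul] at h1
  exact (pow_eq_one_iff_of_nonneg (n := 2 ^ k) (uNorm_nonneg _ _ _) (by positivity)).1
    (by exact_mod_cast h1)

/-- If the Gowers norm of `f` is close to `1`, then `f` is close to having modulus `1`, and its
argument has small iterated differences on average. -/
theorem integral_le_one_sub_uNorm_pow (k : ℕ) (hk : 1 ≤ k) {f : G → ℂ} (hf : Measurable f)
    (hf1 : ∀ x, ‖f x‖ ≤ 1) {φ : G → UnitAddCircle} (hφ : Measurable φ)
    (hfφ : ∀ x, f x = ‖f x‖ * e (φ x)) :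
    ∫ x, (1 - ‖f x‖) ∂μ ≤ 1 - uNorm μ k f ^ 2 ^ k ∧
      (∫ z : G × (Fin k → G), ‖iterDiff k z.2 φ z.1‖ ∂(μ.prod (Measure.pi fun _ => μ))) ^ 2 ≤
        1 - uNorm μ k f ^ 2 ^ k := by
  set ρ := μ.prod (Measure.pi fun _ : Fin k => μ) with hρ
  have hcm : Measurable fun z : G × (Fin k → G) => cube k z.2 f z.1 :=
    measurable_cube hf (by fun_prop) (by fun_prop)
  have hc1 : ∀ z : G × (Fin k → G), ‖cube k z.2 f z.1‖ ≤ ‖f z.1‖ := fun z =>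
    norm_cube_le k z.2 hf1 z.1
  have hci : Integrable (fun z : G × (Fin k → G) => cube k z.2 f z.1) ρ :=
    Integrable.of_bound hcm.aestronglyMeasurable 1 (ae_of_all _ fun z => (hc1 z).trans (hf1 _))
  have hu : uNorm μ k f ^ 2 ^ k = ∫ z, (cube k z.2 f z.1).re ∂ρ := by
    have h1 := congrArg Complex.re (uNorm_pow_eq_integral μ k hk hf hf1)
    rw [Complex.ofReal_re] at h1
    rw [h1]
    exact (integral_re hci).symm
  have hcr : Integrable (fun z : G × (Fin k → G) => (cube k z.2 f z.1).re) ρ := hci.re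
  have hu' : 1 - uNorm μ k f ^ 2 ^ k = ∫ z, (1 - (cube k z.2 f z.1).re) ∂ρ := by
    rw [integral_sub (integrable_const _) hcr, hu]
    simp
  have hfi : Integrable (fun x => ‖f x‖) μ :=
    (Integrable.of_bound hf.aestronglyMeasurable 1 (ae_of_all _ hf1)).norm
  have hre : Integrable (fun z : G × (Fin k → G) => 1 - (cube k z.2 f z.1).re) ρ :=
    (integrable_const _).sub hcr
  rw [hu']
  constructor
  · calc ∫ x, (1 - ‖f x‖) ∂μ = ∫ z, (1 - ‖f z.1‖) ∂ρ := by
          rw [hρ, integral_fun_fst (fun x => 1 - ‖f x‖)]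
          simp
      _ ≤ _ := by
          refine integral_mono ((integrable_const _).sub (hfi.comp_fst _)) hre fun z => ?_
          have := (Complex.re_le_norm _).trans (hc1 z)
          simp only
          linarith
  · set X : G × (Fin k → G) → ℝ := fun z => ‖iterDiff k z.2 φ z.1‖ with hX
    have hXm : Measurable X := (measurable_iterDiff hφ (by fun_prop) (by fun_prop)).norm
    have hX2 : ∀ z, X z ≤ 1 / 2 := fun z => by
      simpa using AddCircle.norm_le_half_period (p := (1 : ℝ)) (x := iterDiff k z.2 φ z.1) one_ne_zero
    have hX0 : ∀ z, 0 ≤ X z := fun z => norm_nonneg _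
    have hXL : MemLp X 2 ρ := MemLp.of_bound hXm.aestronglyMeasurable (1 / 2)
      (ae_of_all _ fun z => by rw [Real.norm_eq_abs, abs_of_nonneg (hX0 z)]; exact hX2 z)
    -- Nonnegative variance reduces the claim to the pointwise bound `X ^ 2 ≤ 1 - Re cube`.
    have hv := ProbabilityTheory.variance_nonneg X ρ
    rw [ProbabilityTheory.variance_eq_sub hXL] at hv
    refine (sub_nonneg.1 hv).trans (integral_mono hXL.integrable_sq hre fun z => ?_)
    have hc := congrArg Complex.re (cube_eq_norm_mul_e k z.2 hfφ z.1)
    rw [Complex.re_ofReal_mul] at hc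
    have h4 := four_mul_norm_le (iterDiff k z.2 φ z.1)
    have hn := norm_e (iterDiff k z.2 φ z.1)
    set w := e (iterDiff k z.2 φ z.1)
    have h5 : ‖w - 1‖ ^ 2 = 2 - 2 * w.re := by
      rw [← Complex.normSq_eq_norm_sq, Complex.normSq_sub, Complex.normSq_eq_norm_sq, hn]
      simp
      ring
    have h6 : (4 * X z) ^ 2 ≤ 2 - 2 * w.re := by
      rw [← h5]
      exact pow_le_pow_left₀ (mul_nonneg (by norm_num) (hX0 z)) h4 2
    have hr : ‖cube k z.2 f z.1‖ ≤ 1 := (hc1 z).trans (hf1 _)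
    have hr0 := norm_nonneg (cube k z.2 f z.1)
    have hXz := hX0 z
    have hXz2 := hX2 z
    simp only [Pi.pow_apply]
    rw [hc]
    -- If `w.re ≥ 0`, the modulus of the cube only shrinks the real part, and `8 * X ^ 2 ≤ 1 -
    -- w.re`. Otherwise the right side is at least 1, while `X ≤ 1 / 2`.
    rcases le_total 0 w.re with hw | hw
    · nlinarith
    · nlinarith

end Cube

end Gowers

namespace Gowers

/-! ### The inverse theorem for bounded Borel functions, and passage to classes -/

section Inverse

theorem isPolynomialDegLT_zero {G : Type*} [AddCommGroup G] [MeasurableSpace G] (μ : Measure G)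
    [SigmaFinite μ] (k : ℕ) :
    IsPolynomialDegLT μ k (fun _ => (0 : UnitAddCircle)) := by
  refine ⟨measurable_const, ae_of_all _ fun z => ?_⟩
  exact iterDiff_map k z.2 (0 : UnitAddCircle →+ UnitAddCircle) (fun _ => 0) z.1

variable {G : Type*} [AddCommGroup G] [MeasurableSpace G] [MeasurableSub₂ G] [MeasurableAdd₂ G]
  [MeasurableNeg G] (μ : Measure G) [IsProbabilityMeasure μ] [μ.IsAddLeftInvariant]
  [μ.IsNegInvariant]

/-- The modulus in the inverse theorem for large Gowers norms. -/
noncomputable def modulus (k : ℕ) (ε : ℝ) : ℝ :=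
  344 * (2 ^ k) ^ 5 * √(2 ^ k * ε) + 2 ^ k * ε

theorem tendsto_modulus (k : ℕ) : Tendsto (modulus k) (𝓝[≥] 0) (𝓝 0) := by
  have h : Continuous (modulus k) := by unfold modulus; fun_prop
  have h0 : modulus k 0 = 0 := by simp [modulus]
  exact (h0 ▸ h.tendsto 0).mono_left nhdsWithin_le_nhds

theorem exists_eLpNorm_sub_le (k : ℕ) (hk : 1 ≤ k) {f : G → ℂ} (hf : Measurable f)
    (hf1 : ∀ x, ‖f x‖ ≤ 1) {ε : ℝ} (hε : 0 ≤ ε) (hfε : 1 - ε ≤ uNorm μ k f) :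
    ∃ P : G → UnitAddCircle, IsPolynomialDegLT μ k P ∧
      eLpNorm (fun x => f x - e (P x)) 1 μ ≤ ENNReal.ofReal (modulus k ε) := by
  set N : ℝ := 2 ^ k with hN
  have hN1 : 1 ≤ N := one_le_pow₀ (by norm_num)
  set σ : ℝ := √(N * ε) with hσ
  have hσ0 : 0 ≤ σ := Real.sqrt_nonneg _
  have hσ2 : σ ^ 2 = N * ε := Real.sq_sqrt (by positivity)
  have hmod : modulus k ε = 344 * N ^ 5 * σ + N * ε := rfl
  have hN5 : 1 ≤ N ^ 5 := one_le_pow₀ hN1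
  by_cases hsmall : 68 * N ^ 5 * σ < 1
  · have hσ1 : σ ≤ 1 := by nlinarith
    have hε1 : ε ≤ 1 := by nlinarith
    -- Bernoulli's inequality.
    have hu : 1 - N * ε ≤ uNorm μ k f ^ 2 ^ k := by
      have h1 := one_add_mul_le_pow (a := -ε) (by linarith) (2 ^ k)
      push_cast at h1
      have h2 : (1 + -ε) ^ 2 ^ k ≤ uNorm μ k f ^ 2 ^ k :=
        pow_le_pow_left₀ (by linarith) (by linarith) _
      linarith
    set φ : G → UnitAddCircle := fun x => circleArg (f x) with hφ
    have hφm : Measurable φ := measurable_circleArg.comp hf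
    obtain ⟨h1, h2⟩ := integral_le_one_sub_uNorm_pow μ k hk hf hf1 hφm
      (fun x => (norm_mul_e_circleArg (f x)).symm)
    have hΔm : Measurable fun z : G × (Fin k → G) => iterDiff k z.2 φ z.1 :=
      measurable_iterDiff hφm (by fun_prop) (by fun_prop)
    have h3 : ∫ z : G × (Fin k → G), ‖iterDiff k z.2 φ z.1‖ ∂(μ.prod (Measure.pi fun _ => μ)) ≤
        σ := by
      refine le_of_sq_le_sq ?_ hσ0
      linarith
    have h4 : ∫⁻ h : Fin k → G, ∫⁻ x, ‖iterDiff k h φ x‖ₑ ∂μ ∂(Measure.pi fun _ => μ) ≤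
        ENNReal.ofReal σ := by
      rw [lintegral_lintegral_swap (hΔm.comp measurable_swap).enorm.aemeasurable,
        ← lintegral_prod (fun z : G × (Fin k → G) => ‖iterDiff k z.2 φ z.1‖ₑ)
          hΔm.enorm.aemeasurable, ← ofReal_integral_norm_eq_lintegral_enorm]
      · exact ENNReal.ofReal_le_ofReal h3
      · exact Integrable.of_bound hΔm.aestronglyMeasurable (1 / 2) (ae_of_all _ fun z => by
          simpa using AddCircle.norm_le_half_period (p := (1 : ℝ)) (x := iterDiff k z.2 φ z.1)
            one_ne_zero)
    obtain ⟨P, hP, hφP⟩ := exists_isPolynomialDegLT μ k hk hφm hσ0 hsmall h4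
    refine ⟨P, hP, ?_⟩
    have hfφ : ∫⁻ x, ‖f x - e (φ x)‖ₑ ∂μ ≤ ENNReal.ofReal (N * ε) := by
      have : Integrable (fun x => f x - e (φ x)) μ :=
        (Integrable.of_bound hf.aestronglyMeasurable 1 (ae_of_all _ hf1)).sub
          (Integrable.of_bound (continuous_e.measurable.comp hφm).aestronglyMeasurable 1
            (ae_of_all _ fun x => (norm_e _).le))
      rw [← ofReal_integral_norm_eq_lintegral_enorm this]
      refine ENNReal.ofReal_le_ofReal ?_
      simp_rw [norm_sub_rev (f _), hφ, fun x => norm_e_circleArg_sub (f x) (hf1 x)]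
      linarith
    rw [eLpNorm_one_eq_lintegral_enorm]
    calc ∫⁻ x, ‖f x - e (P x)‖ₑ ∂μ
        ≤ ∫⁻ x, (8 * ‖φ x - P x‖ₑ + ‖f x - e (φ x)‖ₑ) ∂μ := by
          refine lintegral_mono fun x => ?_
          have h5 : ‖e (φ x) - e (P x)‖ₑ ≤ 8 * ‖φ x - P x‖ₑ := by
            rw [← ofReal_norm, ← ofReal_norm]
            refine (ENNReal.ofReal_le_ofReal (norm_e_sub_e_le _ _)).trans (le_of_eq ?_)
            rw [ENNReal.ofReal_mul (by norm_num), ENNReal.ofReal_ofNat]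
          refine le_trans (le_of_eq ?_) ((enorm_add_le (e (φ x) - e (P x)) _).trans
            (add_le_add_left h5 _))
          congr 1
          abel
      _ ≤ 8 * ENNReal.ofReal (43 * N ^ 4 * σ) + ENNReal.ofReal (N * ε) := by
          have hm : Measurable fun x => 8 * ‖φ x - P x‖ₑ := (hφm.sub hP.1).enorm.const_mul 8
          rw [lintegral_add_left hm,
            lintegral_const_mul' _ _ (by simp)]
          gcongr
      _ ≤ _ := by
          rw [← ENNReal.ofReal_ofNat 8, ← ENNReal.ofReal_mul (by norm_num),
            ← ENNReal.ofReal_add (by positivity) (by positivity), hmod]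
          refine ENNReal.ofReal_le_ofReal ?_
          have h6 : N ^ 4 ≤ N ^ 5 := pow_le_pow_right₀ hN1 (by norm_num)
          have h7 := mul_le_mul_of_nonneg_right h6 hσ0
          linarith
  · refine ⟨fun _ => 0, isPolynomialDegLT_zero μ k, ?_⟩
    -- Outside the small range, `344 * N ^ 5 * σ ≥ 344 / 68 > 2`, so the trivial bound 2 suffices
    -- with `P = 0`. In the small range the coefficient 344 is `8 * 43`, with 8 the Lipschitz
    -- constant used for `e`.
    have h2 : (2 : ℝ) ≤ modulus k ε := by
      have : 0 ≤ N * ε := by positivity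
      rw [hmod]
      linarith
    refine (eLpNorm_le_of_ae_bound (C := 2) (ae_of_all _ fun x => ?_)).trans ?_
    · refine (norm_sub_le _ _).trans ?_
      rw [norm_e]
      linarith [hf1 x]
    · simpa using ENNReal.ofReal_le_ofReal h2

end Inverse

theorem exists_measurable_norm_le_one {G : Type*} [MeasurableSpace G] {μ : Measure G} {f : G → ℂ}
    (hf : AEStronglyMeasurable f μ) (hf1 : eLpNorm f ⊤ μ ≤ 1) :
    ∃ g : G → ℂ, Measurable g ∧ (∀ x, ‖g x‖ ≤ 1) ∧ f =ᵐ[μ] g := by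
  have hm := hf.stronglyMeasurable_mk.measurable
  refine ⟨fun x => if ‖hf.mk f x‖ ≤ 1 then hf.mk f x else 0, ?_, fun x => ?_, ?_⟩
  · exact Measurable.ite (measurableSet_le hm.norm measurable_const) hm measurable_const
  · simp only
    split_ifs with h
    · exact h
    · simp
  · filter_upwards [hf.ae_eq_mk, ae_le_eLpNormEssSup (f := f) (μ := μ)] with x hx hx'
    rw [eLpNorm_exponent_top] at hf1
    have h1 : ‖f x‖ ≤ 1 := by
      have := hx'.trans hf1
      rwa [← ofReal_norm, ENNReal.ofReal_le_one] at this
    rw [← hx, if_pos h1]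

end Gowers

theorem theorem1p4 (k : ℕ) (hk : 1 ≤ k) :
    ∃ c : ℝ → ℝ, Tendsto c (𝓝[≥] 0) (𝓝 0) ∧
      ∀ (G : Type*) [AddCommGroup G] [TopologicalSpace G] [IsTopologicalAddGroup G]
        [CompactSpace G] [T2Space G] [SecondCountableTopology G]
        [MeasurableSpace G] [BorelSpace G]
        (μ : Measure G) [μ.IsAddHaarMeasure] [IsProbabilityMeasure μ]
        (f : G → ℂ), MemLp f ⊤ μ → eLpNorm f ⊤ μ ≤ 1 →
        (Gowers.uNorm μ k f = 1 ↔
          ∃ P : G → UnitAddCircle, Gowers.IsPolynomialDegLT μ k P ∧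
            f =ᵐ[μ] fun x => Gowers.e (P x)) ∧
        ∀ ε : ℝ, 0 ≤ ε → 1 - ε ≤ Gowers.uNorm μ k f →
          ∃ P : G → UnitAddCircle, Gowers.IsPolynomialDegLT μ k P ∧
            eLpNorm (fun x => f x - Gowers.e (P x)) 1 μ ≤ ENNReal.ofReal (c ε) := by
  refine ⟨Gowers.modulus k, Gowers.tendsto_modulus k, ?_⟩
  intro G _ _ _ _ _ _ _ _ μ _ _ f hf hf1
  obtain ⟨g, hgm, hg1, hfg⟩ := Gowers.exists_measurable_norm_le_one hf.1 hf1
  have hfar : ∀ ε : ℝ, 0 ≤ ε → 1 - ε ≤ Gowers.uNorm μ k f →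
      ∃ P : G → UnitAddCircle, Gowers.IsPolynomialDegLT μ k P ∧
        eLpNorm (fun x => f x - Gowers.e (P x)) 1 μ ≤ ENNReal.ofReal (Gowers.modulus k ε) := by
    intro ε hε h
    rw [Gowers.uNorm_congr μ k hfg] at h
    obtain ⟨P, hP, hgP⟩ := Gowers.exists_eLpNorm_sub_le μ k hk hgm hg1 hε h
    refine ⟨P, hP, ?_⟩
    refine (eLpNorm_congr_ae ?_).trans_le hgP
    filter_upwards [hfg] with x hx
    rw [hx]
  refine ⟨⟨fun h => ?_, ?_⟩, hfar⟩
  -- The modulus vanishes at 0, so the `L^1` distance is zero.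
  · obtain ⟨P, hP, hfP⟩ := hfar 0 le_rfl (by rw [h]; simp)
    refine ⟨P, hP, ?_⟩
    have h0 : Gowers.modulus k 0 = 0 := by simp [Gowers.modulus]
    have heP : Measurable fun x => Gowers.e (P x) := Gowers.continuous_e.measurable.comp hP.1
    have hsub : AEStronglyMeasurable (fun x => f x - Gowers.e (P x)) μ :=
      hf.1.sub heP.aestronglyMeasurable
    rw [h0, ENNReal.ofReal_zero, nonpos_iff_eq_zero, eLpNorm_eq_zero_iff hsub one_ne_zero] at hfP
    filter_upwards [hfP] with x hx
    exact sub_eq_zero.1 hx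
  · rintro ⟨P, hP, hfP⟩
    rw [Gowers.uNorm_congr μ k hfP]
    exact Gowers.uNorm_e_eq_one μ k hk hP
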